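/- \textbf{Model.} A computation consists of tasks $v_1,\dots,v_n$ ($n\ge 1$) forming a directed path. The source holds an instance $y_0$; task $v_i$ computes $y_i=f_i(y_{i-1})$, and $y_n$ is the solution. The computation proceeds in rounds. In each round the supervisor assigns a newly sampled worker $p_i$ to the current task $v_i$ (initially $v_1$). Given everything known before the round, the sampled worker is adversarial with probability at most $\beta$, where $\beta\ge 0$ is fixed; otherwise it is honest, and it never changes its status. The worker last assigned to $v_{i-1}$ (the source, if $i=1$) sends its output to $p_i$. An honest $p_i$ checks whether it has received the correct value $y_{i-1}$; if so, it executes $v_i$ and replies DONE, otherwise it replies REJECT. An adversarial worker may send anything or nothing to the worker of the next task or to the target, and may reply DONE or REJECT or not reply at all. The adversary, who controls all adversarial workers, decides on the basis of everything known so far, including the status of the worker just sampled and its own randomness, but it does not know future samples. At the end of the round the supervisor reacts (rollback strategy): after DONE with $i<n$ it continues with $v_{i+1}$; after no reply it repeats $v_i$ with a new worker; after REJECT it goes back to $v_{i-1}$ with a new worker (to $v_1$, if $i=1$); after DONE with $i=n$ it asks $p_n$ to send its output to the target, which accepts it if and only if it equals $y_n$. If the target accepts, the computation has terminated; otherwise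 $v_n$ is repeated with a new worker. The supervisor remembers the worker last assigned to each task before the current one. For each task let arbitrary nonnegative amounts of work be given for receiving its input, verifying its input, executing it, and sending its output once. The total work of the honest workers is the sum of the work of these kinds that they perform during the whole computation (receiving and verifying being charged in every assignment of an honest worker to the task), and the optimal work is its value when no adversarial worker is ever sampled. \textbf{Theorem.} There is a universal constant $C\ge 0$ such that the following holds for every $\beta\in[0,1/12]$. 1. For every $c>0$ there is an $n_0$, depending only on $\beta$ and $c$, such that for every $n\ge n_0$, every such computation on a path of $n$ tasks and every adversarial strategy, with probability at least $1-n^{-c}$ the computation terminates within $(1+C\beta)\,n$ rounds, with the target holding the correct solution. 2. For every $n\ge 1$, every such computation on a path of $n$ tasks and every adversarial strategy, the expected number of times that the source sends the instance is at most $1+C\beta$, the expected number of times that the target is sent an output is at most $1+C\beta$, and the expected total work of the honest workers is at most $(1+C\beta)$ times the optimal work. -/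

import Mathlib

open MeasureTheory
open scoped ENNReal NNReal

namespace SupervisedPath

universe u v

/-- The output of task `v_i` on a correct run: `correctOutput f x 0` is the instance `x` held by the
source, and task `v_i` (for `i ≥ 1`) applies `f i` to the output of task `v_{i-1}`. For a path of
`n` tasks, `correctOutput f x n` is the solution. -/
def correctOutput {D : Type u} (f : ℕ → D → D) (x : D) : ℕ → D
  | 0 => x
  | i + 1 => f (i + 1) (correctOutput f x i)

/-- What the supervisor gets to see from a worker by the end of a round. -/
inductive Reply where
  | silent
  | done
  | reject

/-- The decisions of the adversary in one round, in which a worker `p_i` is assigned to `v_i`.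
* `deliver`: what `p_{i-1}`, if it is adversarial, sends to `p_i` (`none`: nothing);
* `reply`: the reply of `p_i`, if it is adversarial, to the supervisor;
* `forward`: what `p_i`, if it is adversarial and asked to send its output to the target, sends to
  the target (`none`: nothing). -/
structure Move (D : Type u) where
  deliver : Option D
  reply : Reply
  forward : Option D

/-- A worker that was assigned to a task and replied DONE. An honest worker keeps the output it
computed; an adversarial one may later send anything. -/
inductive Worker (D : Type u) where
  | honest (out : D)
  | adversarial

/-- State of the computation between two rounds. In state `running L`, the list `L` consists of the
workers last assigned to `v_{i-1}, …, v_1` (in this order), and in the next round a newly sampled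
worker is assigned to `v_i`, where `i = L.length + 1`. In state `finished y`, the target has
accepted the output `y` and the computation has terminated. -/
inductive State (D : Type u) where
  | running (L : List (Worker D))
  | finished (y : D)

/-- What the worker assigned to the current task receives at the beginning of the round: the
instance from the source if the task is `v_1`, and otherwise whatever the worker last assigned to
the preceding task sends. -/
def received {D : Type u} (x : D) (m : Move D) : List (Worker D) → Option D
  | [] => some x
  | Worker.honest y :: _ => some y
  | Worker.adversarial :: _ => m.deliver

open Classical in
/-- An honest worker assigned to `v_{k+1}` verifies the received data: it accepts exactly the
correct output of `v_k` (the instance, if `k = 0`), and then executes `v_{k+1}` on it. The value is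
the output it computes, or `none` if it rejects. -/
noncomputable def honestOutput {D : Type u} (f : ℕ → D → D) (x : D) (m : Move D)
    (L : List (Worker D)) : Option D :=
  match received x m L with
  | some z => if z = correctOutput f x L.length then some (f (L.length + 1) z) else none
  | none => none

/-- The reply to the supervisor of the worker assigned to the current task; `a` tells whether this
worker is adversarial. -/
noncomputable def replyOf {D : Type u} (f : ℕ → D → D) (x : D) (a : Bool) (m : Move D)
    (L : List (Worker D)) : Reply :=
  if a = true then m.reply
  else if (honestOutput f x m L).isSome then Reply.done else Reply.reject

/-- What the worker assigned to the last task sends to the target when it is asked to do so. -/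
noncomputable def toTarget {D : Type u} (f : ℕ → D → D) (x : D) (a : Bool) (m : Move D)
    (L : List (Worker D)) : Option D :=
  if a = true then m.forward else honestOutput f x m L

open Classical in
/-- One round of the rollback strategy on the path `v_1, …, v_n`: the newly sampled worker (which is
adversarial if and only if `a = true`) is assigned to the current task and the supervisor reacts to
its reply.
* No reply: the same task is assigned to a new worker in the next round.
* REJECT: rollback to the preceding task (for `v_1`, a new worker for `v_1`).
* DONE for a task other than the last one: continue with the next task.
* DONE for the last task: the worker is asked to send its output to the target, which accepts
  exactly the correct solution. If it accepts, the computation terminates; if it rejects, a new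
  worker is assigned to the last task in the next round. -/
noncomputable def step {D : Type u} (n : ℕ) (f : ℕ → D → D) (x : D) (a : Bool) (m : Move D) :
    State D → State D
  | State.finished y => State.finished y
  | State.running L =>
    match replyOf f x a m L with
    | Reply.silent => State.running L
    | Reply.reject => State.running L.tail
    | Reply.done =>
      if L.length + 1 < n then
        if a = true then State.running (Worker.adversarial :: L)
        else
          match honestOutput f x m L with
          | some y => State.running (Worker.honest y :: L)
          | none => State.running L
      else
        match toTarget f x a m L with
        | some y =>
          if y = correctOutput f x n then State.finished y else State.running L
        | none => State.running L

/-- The state after `t` rounds, given which of the workers sampled in rounds `0, 1, 2, …` are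
adversarial and the moves of the adversary in these rounds. -/
noncomputable def stateAfter {D : Type u} (n : ℕ) (f : ℕ → D → D) (x : D)
    (a : ℕ → Bool) (m : ℕ → Move D) : ℕ → State D
  | 0 => State.running []
  | t + 1 => step n f x (a t) (m t) (stateAfter n f x a m t)

/-- Number of times (0 or 1) the source sends the instance in a round that starts in state `s`. -/
def sourceSends {D : Type u} : State D → ℝ≥0∞
  | State.running [] => 1
  | State.running (_ :: _) => 0
  | State.finished _ => 0

open Classical in
/-- Number of times (0 or 1) the target is sent an output (correct, wrong or missing) in a round
that starts in state `s`: this happens when the worker assigned to the last task replies DONE. -/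
noncomputable def targetReceives {D : Type u} (n : ℕ) (f : ℕ → D → D) (x : D) (a : Bool)
    (m : Move D) : State D → ℝ≥0∞
  | State.running L => if n ≤ L.length + 1 ∧ replyOf f x a m L = Reply.done then 1 else 0
  | State.finished _ => 0

/-- The communication and computational work associated with the tasks. For task `v_i`:
* `receive i`: receiving the input of `v_i` (including the communication with the supervisor);
* `verify i`: verifying the input of `v_i`;
* `execute i`: executing `v_i`;
* `send i`: sending the output of `v_i` once. -/
structure Work where
  receive : ℕ → ℝ≥0
  verify : ℕ → ℝ≥0
  execute : ℕ → ℝ≥0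
  send : ℕ → ℝ≥0

/-- Work in one round of the worker assigned to the current task, if it is honest: it receives and
verifies its input (this is charged even if nothing arrives), and if it accepts then it executes the
task. If the task is the last one then it also sends its output to the target. -/
noncomputable def currentWorkerWork {D : Type u} (n : ℕ) (f : ℕ → D → D) (x : D) (w : Work)
    (a : Bool) (m : Move D) (L : List (Worker D)) : ℝ≥0 :=
  if a = true then 0
  else w.receive (L.length + 1) + w.verify (L.length + 1) +
    (if (honestOutput f x m L).isSome then
      w.execute (L.length + 1) + (if n ≤ L.length + 1 then w.send (L.length + 1) else 0)
    else 0)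

/-- Work in one round of the worker last assigned to the preceding task, if it is honest: it sends
its output to the worker assigned to the current task. -/
def precedingWorkerWork {D : Type u} (w : Work) : List (Worker D) → ℝ≥0
  | [] => 0
  | Worker.honest _ :: L => w.send (L.length + 1)
  | Worker.adversarial :: _ => 0

/-- Total work of the honest workers in a round that starts in state `s`. -/
noncomputable def honestWork {D : Type u} (n : ℕ) (f : ℕ → D → D) (x : D) (w : Work)
    (a : Bool) (m : Move D) : State D → ℝ≥0∞
  | State.running L =>
    ((currentWorkerWork n f x w a m L + precedingWorkerWork w L : ℝ≥0) : ℝ≥0∞)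
  | State.finished _ => 0

/-- Number of times the source sends the instance during the whole computation. -/
noncomputable def sourceCount {D : Type u} (n : ℕ) (f : ℕ → D → D) (x : D)
    (a : ℕ → Bool) (m : ℕ → Move D) : ℝ≥0∞ :=
  ∑' t, sourceSends (stateAfter n f x a m t)

/-- Number of times the target is sent an output during the whole computation. -/
noncomputable def targetCount {D : Type u} (n : ℕ) (f : ℕ → D → D) (x : D)
    (a : ℕ → Bool) (m : ℕ → Move D) : ℝ≥0∞ :=
  ∑' t, targetReceives n f x (a t) (m t) (stateAfter n f x a m t)

/-- Total work of the honest workers during the whole computation. -/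
noncomputable def totalHonestWork {D : Type u} (n : ℕ) (f : ℕ → D → D) (x : D) (w : Work)
    (a : ℕ → Bool) (m : ℕ → Move D) : ℝ≥0∞ :=
  ∑' t, honestWork n f x w (a t) (m t) (stateAfter n f x a m t)

/-- The optimal work: the total work when no adversarial worker is ever sampled. (The moves of the
adversary then have no effect.) -/
noncomputable def optimalWork {D : Type u} (n : ℕ) (f : ℕ → D → D) (x : D) (w : Work) : ℝ≥0∞ :=
  totalHonestWork n f x w (fun _ => false) (fun _ => ⟨none, Reply.silent, none⟩)

/-- A sampling mechanism and an adversarial strategy on the probability space `(Ω, μ)`.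
`info t` is everything that is known before the worker of round `t` is sampled, which may include
any internal randomness of the adversary. The sampled worker is adversarial with probability at most
`β` whatever is known before. The adversary chooses its move after it has seen who was sampled, and
on the basis of all that is known so far. -/
structure Scenario {Ω : Type v} [mΩ : MeasurableSpace Ω] (μ : Measure Ω) (β : ℝ≥0)
    (D : Type u) where
  info : Filtration ℕ mΩ
  isAdv : ℕ → Ω → Bool
  move : ℕ → Ω → Move D
  isAdv_known : ∀ t, MeasurableSet[info (t + 1)] {ω | isAdv t ω = true}
  deliver_known : ∀ t d, MeasurableSet[info (t + 1)] {ω | (move t ω).deliver = d}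
  reply_known : ∀ t r, MeasurableSet[info (t + 1)] {ω | (move t ω).reply = r}
  forward_known : ∀ t d, MeasurableSet[info (t + 1)] {ω | (move t ω).forward = d}
  sampling : ∀ t (A : Set Ω), MeasurableSet[info t] A →
    μ (A ∩ {ω | isAdv t ω = true}) ≤ (β : ℝ≥0∞) * μ A

end SupervisedPath

namespace SupervisedPath

universe u v

/-! Honest workers verify their input, so every remembered honest worker holds a correct output.
Hence the course of the computation depends only on which remembered workers are adversarial, a
stack of flags (`State.Sound.step`), and two potentials on such stacks carry the theorem.

Termination: let the balance of a stack be its honest minus its adversarial entries. While the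
computation runs, an honest round raises the balance by at least one (it pushes an honest entry or
pops an adversarial one), and an adversarial round lowers it by at most one. The balance stays below
`n`, so `n` plus twice the number of adversarial samples suffices as a number of rounds
(`eq_finished_of_advCount`). The exponential moment of that number with base 2 and Markov's
inequality give the tail bound.

Expectations: source sends, target sends and honest work are controlled by the numbers of rounds at
each level. For fixed `i`, `visitPotential` is a supersolution against every adversarial move
(`exists_visitPotential_bounds`): its expected decrease in a round pays for a visit to level `i`.
Telescoping bounds the expected visits by its initial value, at most `1 + 20β`
(`tsum_lintegral_atLevel_le`). A run without adversaries visits each level once, so weighting the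
levels by their work compares the expected work with the optimum. -/

instance : Finite Reply :=
  Finite.of_surjective (fun i : Fin 3 => ![Reply.silent, Reply.done, Reply.reject] i) (by
    rintro (_ | _ | _)
    exacts [⟨0, rfl⟩, ⟨1, rfl⟩, ⟨2, rfl⟩])

/-! ### Reduction of the computation to stacks of flags -/

/-- Whether a worker is adversarial. -/
def Worker.flag {D : Type u} : Worker D → Bool
  | Worker.honest _ => false
  | Worker.adversarial => true

/-- The part of the state on which the course of the computation depends: which of the remembered
workers are adversarial (`none` if the computation has terminated). -/
def State.flags {D : Type u} : State D → Option (List Bool)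
  | State.running L => some (L.map Worker.flag)
  | State.finished _ => none

/-- All honest workers in the list hold the correct outputs of their tasks. -/
def SoundStack {D : Type u} (f : ℕ → D → D) (x : D) : List (Worker D) → Prop
  | [] => True
  | Worker.honest y :: L => y = correctOutput f x (L.length + 1) ∧ SoundStack f x L
  | Worker.adversarial :: L => SoundStack f x L

/-- The invariant of the computation. -/
def State.Sound {D : Type u} (n : ℕ) (f : ℕ → D → D) (x : D) : State D → Prop
  | State.running L => L.length < n ∧ SoundStack f x L
  | State.finished y => y = correctOutput f x n

/-- One round on the level of flags: `a` tells whether the sampled worker is adversarial, `d` and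
`g` whether the messages of the adversary to the sampled worker and to the target are correct. -/
def flagStep (n : ℕ) (a d : Bool) (r : Reply) (g : Bool) :
    Option (List Bool) → Option (List Bool)
  | none => none
  | some L =>
    if a = true then
      match r with
      | Reply.silent => some L
      | Reply.reject => some L.tail
      | Reply.done => if L.length + 1 < n then some (true :: L) else if g = true then none else some L
    else if L.head? = some true ∧ d = false then some L.tail
    else if L.length + 1 < n then some (false :: L) else none

/-- The number of the tasks completed before the current one. -/
def level (l : Option (List Bool)) : ℕ := (l.getD []).length

lemma SoundStack.tail {D : Type u} {f : ℕ → D → D} {x : D} :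
    ∀ {L : List (Worker D)}, SoundStack f x L → SoundStack f x L.tail
  | [], h => h
  | Worker.honest _ :: _, h => h.2
  | Worker.adversarial :: _, h => h

open Classical in
lemma honestOutput_eq {D : Type u} {f : ℕ → D → D} {x : D} (m : Move D) {L : List (Worker D)}
    (h : SoundStack f x L) :
    honestOutput f x m L =
      if (L.map Worker.flag).head? = some true ∧ m.deliver ≠ some (correctOutput f x L.length)
      then none else some (correctOutput f x (L.length + 1)) := by
  rcases L with _ | ⟨_ | _, L⟩
  · simp [honestOutput, received, correctOutput]
  · simp only [SoundStack] at h
    simp [honestOutput, received, correctOutput, Worker.flag, h.1]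
  · rcases hd : m.deliver with _ | z
    · simp [honestOutput, received, hd, Worker.flag]
    · by_cases hz : z = correctOutput f x (L.length + 1)
      · simp [honestOutput, received, hd, Worker.flag, hz, correctOutput]
      · simp [honestOutput, received, hd, Worker.flag, hz]

-- Verification filters out wrong values, so an adversarial message matters only through its
-- correctness. Soundness and the flag transition are proved together because the transition is
-- valid only on sound states.
open Classical in
lemma State.Sound.step {D : Type u} {n : ℕ} {f : ℕ → D → D} {x : D} (a : Bool) (m : Move D)
    {s : State D} (h : s.Sound n f x) :
    (step n f x a m s).Sound n f x ∧
      (SupervisedPath.step n f x a m s).flags =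
        flagStep n a (decide (m.deliver = some (correctOutput f x (level s.flags)))) m.reply
          (decide (m.forward = some (correctOutput f x n))) s.flags := by
  rcases s with L | y
  swap
  · exact ⟨h, rfl⟩
  obtain ⟨hn, hL⟩ := h
  have htail : (State.running L.tail).Sound n f x :=
    ⟨by simp; omega, hL.tail⟩
  have hstay : (State.running L).Sound n f x := ⟨hn, hL⟩
  have hlev : level (State.running L).flags = L.length := by simp [level, State.flags]
  rw [hlev]
  rcases a with _ | _
  · have ho := honestOutput_eq (f := f) (x := x) m hL
    by_cases hc : (L.map Worker.flag).head? = some true ∧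
        m.deliver ≠ some (correctOutput f x L.length)
    · rw [if_pos hc] at ho
      have hs : SupervisedPath.step n f x false m (State.running L) = State.running L.tail := by
        simp [SupervisedPath.step, replyOf, ho]
      rw [hs]
      refine ⟨htail, ?_⟩
      have : (L.map Worker.flag).head? = some true ∧
        decide (m.deliver = some (correctOutput f x L.length)) = false := by simpa using hc
      simp only [State.flags, flagStep, if_pos this]
      simp
    · rw [if_neg hc] at ho
      have h' : ¬ ((L.map Worker.flag).head? = some true ∧
        decide (m.deliver = some (correctOutput f x L.length)) = false) := by simpa using hc
      simp only [State.flags, flagStep, if_neg h', List.length_map]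
      by_cases hlt : L.length + 1 < n
      · have hs : SupervisedPath.step n f x false m (State.running L) =
            State.running (Worker.honest (correctOutput f x (L.length + 1)) :: L) := by
          simp [SupervisedPath.step, replyOf, ho, hlt]
        rw [hs]
        exact ⟨⟨hlt, rfl, hL⟩, by simp [hlt, Worker.flag]⟩
      · have hn' : L.length + 1 = n := by omega
        have hs : SupervisedPath.step n f x false m (State.running L) =
            State.finished (correctOutput f x n) := by
          simp [SupervisedPath.step, replyOf, toTarget, ho, hn']
        rw [hs]
        exact ⟨rfl, by simp [hlt]⟩
  · rcases hr : m.reply with _ | _ | _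
    · have hs : SupervisedPath.step n f x true m (State.running L) = State.running L := by
        simp [SupervisedPath.step, replyOf, hr]
      rw [hs]
      exact ⟨hstay, by simp [State.flags, flagStep]⟩
    · by_cases hlt : L.length + 1 < n
      · have hs : SupervisedPath.step n f x true m (State.running L) =
            State.running (Worker.adversarial :: L) := by
          simp [SupervisedPath.step, replyOf, hr, hlt]
        rw [hs]
        exact ⟨⟨hlt, hL⟩, by simp [State.flags, flagStep, hlt, Worker.flag]⟩
      · rcases hf : m.forward with _ | y
        · have hs : SupervisedPath.step n f x true m (State.running L) = State.running L := by
            simp [SupervisedPath.step, replyOf, hr, hlt, toTarget, hf]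
          rw [hs]
          exact ⟨hstay, by simp [State.flags, flagStep, hlt]⟩
        · by_cases hy : y = correctOutput f x n
          · have hs : SupervisedPath.step n f x true m (State.running L) =
                State.finished (correctOutput f x n) := by
              simp [SupervisedPath.step, replyOf, hr, hlt, toTarget, hf, hy]
            rw [hs]
            exact ⟨rfl, by simp [State.flags, flagStep, hlt, hy]⟩
          · have hs : SupervisedPath.step n f x true m (State.running L) = State.running L := by
              simp [SupervisedPath.step, replyOf, hr, hlt, toTarget, hf, hy]
            rw [hs]
            exact ⟨hstay, by simp [State.flags, flagStep, hlt, hy]⟩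
    · have hs : SupervisedPath.step n f x true m (State.running L) = State.running L.tail := by
        simp [SupervisedPath.step, replyOf, hr]
      rw [hs]
      exact ⟨htail, by simp [State.flags, flagStep]⟩

lemma sound_stateAfter {D : Type u} {n : ℕ} (hn : 1 ≤ n) (f : ℕ → D → D) (x : D)
    (a : ℕ → Bool) (m : ℕ → Move D) (t : ℕ) : (stateAfter n f x a m t).Sound n f x := by
  induction t with
  | zero => exact ⟨hn, trivial⟩
  | succ t ih => exact (ih.step (a t) (m t)).1

/-- Together with `flagStep_true`, this is all that both potential arguments use about a
nonterminating round; the tests `d`, `g` and the reply become irrelevant. -/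
lemma flagStep_false {n : ℕ} {d g : Bool} {r : Reply} {L L' : List Bool}
    (h : flagStep n false d r g (some L) = some L') :
    L' = false :: L ∨ (L.head? = some true ∧ L' = L.tail) := by
  simp only [flagStep, Bool.false_eq_true, if_false] at h
  split_ifs at h with h1
  · exact Or.inr ⟨h1.1, (Option.some.inj h).symm⟩
  · exact Or.inl (Option.some.inj h).symm

lemma flagStep_true {n : ℕ} {d g : Bool} {r : Reply} {L L' : List Bool}
    (h : flagStep n true d r g (some L) = some L') :
    L' = true :: L ∨ L' = L ∨ L' = L.tail := by
  rcases r with _ | _ | _ <;> simp only [flagStep, if_true] at h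
  · exact Or.inr (Or.inl (Option.some.inj h).symm)
  · split_ifs at h
    · exact Or.inl (Option.some.inj h).symm
    · exact Or.inr (Or.inl (Option.some.inj h).symm)
  · exact Or.inr (Or.inr (Option.some.inj h).symm)

/-! ### Pathwise delay bound by the balance -/

/-- Number of honest minus number of adversarial workers. -/
def balance (L : List Bool) : ℤ := (L.map fun b => if b = true then (-1 : ℤ) else 1).sum

lemma balance_le_length (L : List Bool) : balance L ≤ L.length := by
  induction L with
  | nil => simp [balance]
  | cons b L ih => cases b <;> simp [balance] at ih ⊢ <;> omega

lemma balance_flagStep {n : ℕ} {a d g : Bool} {r : Reply} {L L' : List Bool}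
    (h : flagStep n a d r g (some L) = some L') :
    balance L + (if a = true then -1 else 1) ≤ balance L' := by
  rcases a with _ | _
  · rcases flagStep_false h with rfl | ⟨h1, rfl⟩
    · simp [balance]
    · rcases L with _ | ⟨_ | _, L⟩ <;> simp [balance] at h1 ⊢
  · rcases flagStep_true h with rfl | rfl | rfl
    · simp [balance]
    · simp
    · rcases L with _ | ⟨_ | _, L⟩ <;> simp [balance]; omega

/-- Number of adversarial workers sampled in the first `t` rounds. -/
def advCount (a : ℕ → Bool) (t : ℕ) : ℕ := ∑ s ∈ Finset.range t, if a s = true then 1 else 0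

lemma le_balance_stateAfter {D : Type u} {n : ℕ} (hn : 1 ≤ n) (f : ℕ → D → D) (x : D)
    (a : ℕ → Bool) (m : ℕ → Move D) (t : ℕ) :
    ∀ L, (stateAfter n f x a m t).flags = some L → (t : ℤ) - 2 * advCount a t ≤ balance L := by
  induction t with
  | zero =>
    intro L hL
    obtain rfl : [] = L := by simpa [stateAfter, State.flags] using hL
    simp [advCount, balance]
  | succ t ih =>
    intro L hL
    rw [stateAfter, ((sound_stateAfter hn f x a m t).step (a t) (m t)).2] at hL
    rcases hs : (stateAfter n f x a m t).flags with _ | L₀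
    · rw [hs] at hL
      simp [flagStep] at hL
    · rw [hs] at hL
      have h1 := ih L₀ hs
      have h2 := balance_flagStep hL
      rw [advCount, Finset.sum_range_succ, ← advCount]
      split_ifs at h2 ⊢ <;> push_cast <;> omega

/-- Every adversarial worker delays the computation by at most two rounds. -/
lemma eq_finished_of_advCount {D : Type u} {n : ℕ} (hn : 1 ≤ n) (f : ℕ → D → D) (x : D)
    (a : ℕ → Bool) (m : ℕ → Move D) (t : ℕ) (ht : n + 2 * advCount a t ≤ t) :
    stateAfter n f x a m t = State.finished (correctOutput f x n) := by
  have hs := sound_stateAfter hn f x a m t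
  rcases h : stateAfter n f x a m t with L | y
  · rw [h] at hs
    have h1 := le_balance_stateAfter hn f x a m t (L.map Worker.flag) (by rw [h]; rfl)
    have h2 := balance_le_length (L.map Worker.flag)
    have h3 := hs.1
    rw [List.length_map] at h2
    omega
  · rw [h] at hs
    rw [show y = _ from hs]

/-! ### The potential for visits to a fixed level -/

/-- An upper bound for the expected number of rounds that start at level `i`, from now on, when the
flags of the remembered workers are given by the list. -/
noncomputable def visitPotential (β : ℝ) (i : ℕ) : List Bool → ℝ
  | [] => 1 + 20 * β - 9 * β * (1 / 2) ^ i
  | b :: L =>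
    if L.length < i then
      if b = true then 1 + 20 * β + 3 * (1 / 2) ^ (i - (L.length + 1))
      else 1 + 20 * β - 9 * β * (1 / 2) ^ (i - (L.length + 1))
    else (if b = true then 5 / 4 else 2 * β) * visitPotential β i L

lemma visitPotential_nonneg {β : ℝ} (h0 : 0 ≤ β) (i : ℕ) (L : List Bool) :
    0 ≤ visitPotential β i L := by
  have hq : ∀ k : ℕ, 9 * β * (1 / 2 : ℝ) ^ k ≤ 9 * β := fun k =>
    mul_le_of_le_one_right (by positivity) (pow_le_one₀ (by norm_num) (by norm_num))
  induction L with
  | nil => rw [visitPotential]; linarith [hq i]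
  | cons b L ih =>
    rw [visitPotential]
    split_ifs
    · positivity
    · linarith [hq (i - (L.length + 1))]
    · positivity
    · positivity

/-- The value of the potential at levels up to `i` depends on the last worker and the level only. -/
lemma visitPotential_of_length_le (β : ℝ) {i : ℕ} {L : List Bool} (hL : L.length ≤ i) :
    visitPotential β i L =
      if L.head? = some true then 1 + 20 * β + 3 * (1 / 2) ^ (i - L.length)
      else 1 + 20 * β - 9 * β * (1 / 2) ^ (i - L.length) := by
  rcases L with _ | ⟨b, L⟩
  · simp [visitPotential]
  · have : L.length < i := by simpa using hL
    rw [visitPotential, if_pos this]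
    simp

/-- The adversarial top entry is the worse one. This serves after a rollback, when the flag of the
newly exposed entry is unknown. -/
lemma visitPotential_le {β : ℝ} (h0 : 0 ≤ β) {i : ℕ} {L : List Bool} (hL : L.length ≤ i) :
    visitPotential β i L ≤ 1 + 20 * β + 3 * (1 / 2) ^ (i - L.length) := by
  rw [visitPotential_of_length_le β hL]
  have : (0 : ℝ) ≤ (1 / 2) ^ (i - L.length) := by positivity
  split_ifs
  · exact le_rfl
  · nlinarith

/-- The potential is a supersolution: `H` bounds it after a round with an honest worker and `B`
after an arbitrary round. -/
lemma exists_visitPotential_bounds {β : ℝ} (h0 : 0 ≤ β) (h1 : β ≤ 1 / 12) (i : ℕ)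
    (L : List Bool) :
    ∃ H B : ℝ, 0 ≤ H ∧ H ≤ B ∧ visitPotential β i (false :: L) ≤ H ∧
      (L.head? = some true → visitPotential β i L.tail ≤ H) ∧
      visitPotential β i (true :: L) ≤ B ∧ visitPotential β i L ≤ B ∧
      visitPotential β i L.tail ≤ B ∧
      (if L.length = i then 1 else 0) + ((1 - β) * H + β * B) ≤ visitPotential β i L := by
  have hpos := visitPotential_nonneg (β := β) h0 i
  -- Below level `i` the corrections double with each step towards `i`, so pushing an honest entry
  -- lowers the potential enough to pay for the adversarial risk. Level `i` itself must also pay for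
  -- the visit. Above it the potential is multiplicative: the factors `y = 2β` and `x = 5/4` satisfy
  -- `(1 - β)y² + β ≤ y` and `(1 - β) + βx² ≤ x`.
  rcases lt_trichotomy L.length i with hlt | rfl | hgt
  · obtain ⟨k, rfl⟩ : ∃ k, i = L.length + k + 1 := ⟨i - L.length - 1, by omega⟩
    set i := L.length + k + 1 with hi
    have hq : (0 : ℝ) < (1 / 2) ^ k := by positivity
    have hq1 : (1 / 2 : ℝ) ^ k ≤ 1 := pow_le_one₀ (by norm_num) (by norm_num)
    set q : ℝ := (1 / 2) ^ k with hqd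
    have e0 : visitPotential β i (false :: L) = 1 + 20 * β - 9 * β * q := by
      rw [visitPotential, if_pos hlt, show i - (L.length + 1) = k by omega]; simp [hqd]
    have e1 : visitPotential β i (true :: L) = 1 + 20 * β + 3 * q := by
      rw [visitPotential, if_pos hlt, show i - (L.length + 1) = k by omega]; simp [hqd]
    have e2 := visitPotential_of_length_le β hlt.le
    rw [show i - L.length = k + 1 by omega, pow_succ, ← hqd] at e2
    have e3 : L ≠ [] → visitPotential β i L.tail ≤ 1 + 20 * β + 3 * (q * (1 / 2) * (1 / 2)) := by
      intro hne
      have hl := List.length_pos_iff.2 hne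
      have := visitPotential_le h0 (i := i) (L := L.tail) (by simp; omega)
      rwa [List.length_tail, show i - (L.length - 1) = k + 1 + 1 by omega, pow_succ, pow_succ,
        ← hqd] at this
    have e4 : visitPotential β i L ≤ 1 + 20 * β + 3 * q := by
      rw [e2]; split_ifs <;> nlinarith
    have e5 : visitPotential β i L.tail ≤ 1 + 20 * β + 3 * q := by
      by_cases hne : L = []
      · simpa [hne] using e4
      · linarith [e3 hne]
    have hβq : 0 ≤ β * q := by positivity
    have hβq1 : β * q ≤ q / 12 := by nlinarith
    have hββq : β * (β * q) ≤ β * q / 12 := by nlinarith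
    rw [if_neg hlt.ne]
    by_cases ht : L.head? = some true
    · rw [if_pos ht] at e2
      have hne : L ≠ [] := by rintro rfl; simp at ht
      -- With an adversarial top, an honest worker may reject; the value one level further down then
      -- dominates that of an honest push.
      refine ⟨1 + 20 * β + 3 * (q * (1 / 2) * (1 / 2)), 1 + 20 * β + 3 * q, by positivity,
        by linarith, by rw [e0]; linarith, fun _ => e3 hne, e1.le, e4, e5, ?_⟩
      rw [e2]
      nlinarith
    · rw [if_neg ht] at e2
      refine ⟨1 + 20 * β - 9 * β * q, 1 + 20 * β + 3 * q, by nlinarith,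
        by linarith, e0.le, fun h => absurd h ht, e1.le, e4, e5, ?_⟩
      rw [e2]
      nlinarith
  · set i := L.length with hi
    set v := visitPotential β i L with hv
    have e0 : visitPotential β i (false :: L) = 2 * β * v := by
      rw [visitPotential, if_neg (by omega)]; simp [hv]
    have e1 : visitPotential β i (true :: L) = 5 / 4 * v := by
      rw [visitPotential, if_neg (by omega)]; simp [hv]
    have e2 := visitPotential_of_length_le (L := L) β hi.ge
    rw [← hv, ← hi, Nat.sub_self, pow_zero] at e2
    have e3 : L ≠ [] → visitPotential β i L.tail ≤ 1 + 20 * β + 3 / 2 := by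
      intro hne
      have hl := List.length_pos_iff.2 hne
      have := visitPotential_le h0 (i := i) (L := L.tail) (by simp; omega)
      rw [List.length_tail, show i - (L.length - 1) = 1 by omega, pow_one] at this
      linarith
    rw [if_pos rfl]
    have hv0 : 0 ≤ v := hpos L
    by_cases ht : L.head? = some true
    · rw [if_pos ht] at e2
      have hne : L ≠ [] := by rintro rfl; simp at ht
      -- Here `v = 4 + 20β`. A rollback costs at most `5/2 + 20β`, which leaves `3/2` for the
      -- current visit and the adversarial risk.
      refine ⟨1 + 20 * β + 3 / 2, 5 / 4 * v, by positivity, by rw [e2]; linarith,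
        by rw [e0, e2]; nlinarith, fun _ => e3 hne, e1.le, by linarith,
        (e3 hne).trans (by rw [e2]; linarith), ?_⟩
      rw [e2]
      nlinarith
    · rw [if_neg ht] at e2
      have hB : v ≤ 1 + 20 * β + 3 := by rw [e2]; linarith
      -- Here `v = 1 + 11β`: one unit pays for the visit, and `11β` covers both the return from
      -- above and the adversarial risk. This uses `β ≤ 1/12`.
      refine ⟨2 * β * v, 1 + 20 * β + 3, by positivity, by nlinarith, e0.le,
        fun h => absurd h ht, by rw [e1, e2]; linarith, hB, ?_, ?_⟩
      · by_cases hne : L = []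
        · rw [hne, List.tail_nil, ← hne]; exact hB
        · linarith [e3 hne]
      · have : β * v ≤ β * (1 + 20 * β) := mul_le_mul_of_nonneg_left (by linarith) h0
        have h2 : 0 ≤ β * (β * v) := by positivity
        nlinarith
  · rcases L with _ | ⟨b, L⟩
    · simp at hgt
    have hge : ¬ L.length < i := by simp at hgt; omega
    have hge' : ¬ (b :: L).length < i := by simp at hgt ⊢; omega
    have hv := hpos L
    have e : visitPotential β i (b :: L) =
        (if b = true then 5 / 4 else 2 * β) * visitPotential β i L := by
      rw [visitPotential, if_neg hge]
    have e0 : visitPotential β i (false :: b :: L) = 2 * β * visitPotential β i (b :: L) := by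
      rw [visitPotential, if_neg hge']; simp
    have e1 : visitPotential β i (true :: b :: L) = 5 / 4 * visitPotential β i (b :: L) := by
      rw [visitPotential, if_neg hge']; simp
    rw [if_neg hgt.ne', e0, e1, e, List.tail_cons]
    set w := visitPotential β i L
    have hβw : 0 ≤ β * w := by positivity
    have hβw1 : β * w ≤ w / 12 := by nlinarith
    have hββw : β * (β * w) ≤ β * w / 12 := by nlinarith
    rcases b with _ | _
    · simp only [Bool.false_eq_true, if_false]
      have hβββw : 0 ≤ β * (β * (β * w)) := by positivity
      exact ⟨2 * β * (2 * β * w), w, by positivity, by nlinarith, le_rfl, by simp, by linarith,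
        by linarith, le_rfl, by nlinarith⟩
    · simp only [if_true]
      exact ⟨w, 5 / 4 * (5 / 4 * w), hv, by linarith, by linarith, fun _ => le_rfl, le_rfl,
        by linarith, by linarith, by linarith⟩

/-! ### Measurability and sampling estimates -/

section
variable {Ω : Type v} [mΩ : MeasurableSpace Ω] {μ : Measure Ω} {β : ℝ≥0} {D : Type u}

namespace Scenario

/-- The flags of the state after `t` rounds. -/
noncomputable def flagsAfter (S : Scenario μ β D) (n : ℕ) (f : ℕ → D → D) (x : D) (t : ℕ) (ω : Ω) :
    Option (List Bool) :=
  (stateAfter n f x (fun s => S.isAdv s ω) (fun s => S.move s ω) t).flags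

open Classical in
lemma flagsAfter_succ (S : Scenario μ β D) {n : ℕ} (hn : 1 ≤ n) (f : ℕ → D → D) (x : D) (t : ℕ)
    (ω : Ω) :
    S.flagsAfter n f x (t + 1) ω = flagStep n (S.isAdv t ω)
      (decide ((S.move t ω).deliver = some (correctOutput f x (level (S.flagsAfter n f x t ω)))))
      (S.move t ω).reply (decide ((S.move t ω).forward = some (correctOutput f x n)))
      (S.flagsAfter n f x t ω) :=
  ((sound_stateAfter hn f x _ _ t).step (S.isAdv t ω) (S.move t ω)).2

lemma measurableSet_isAdv (S : Scenario μ β D) (t : ℕ) : MeasurableSet {ω | S.isAdv t ω = true} :=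
  S.info.le _ _ (S.isAdv_known t)

/-- Flag states are countable and a move enters only through its reply and equality tests with fixed
values, so no measurable structure on `D` is needed. -/
lemma measurableSet_flagsAfter (S : Scenario μ β D) {n : ℕ} (hn : 1 ≤ n) (f : ℕ → D → D) (x : D)
    (t : ℕ) (l : Option (List Bool)) :
    MeasurableSet[S.info t] {ω | S.flagsAfter n f x t ω = l} := by
  classical
  induction t generalizing l with
  | zero => exact MeasurableSet.const (some [] = l)
  | succ t ih =>
    have hb : ∀ (p : Ω → Prop) [DecidablePred p] (b : Bool),
        MeasurableSet[S.info (t + 1)] {ω | p ω} →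
        MeasurableSet[S.info (t + 1)] {ω | decide (p ω) = b} := by
      rintro p _ (_ | _) hp
      · simpa [Set.compl_def] using hp.compl
      · simpa using hp
    have key : {ω | S.flagsAfter n f x (t + 1) ω = l} =
        ⋃ (l' : Option (List Bool)) (a : Bool) (d : Bool) (r : Reply) (g : Bool)
          (_ : flagStep n a d r g l' = l),
          {ω | S.flagsAfter n f x t ω = l'} ∩
          ({ω | decide (S.isAdv t ω = true) = a} ∩
          ({ω | decide ((S.move t ω).deliver = some (correctOutput f x (level l'))) = d} ∩
          ({ω | (S.move t ω).reply = r} ∩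
          {ω | decide ((S.move t ω).forward = some (correctOutput f x n)) = g}))) := by
      ext ω
      simp only [Set.mem_iUnion, Set.mem_inter_iff, Set.mem_ofPred_eq]
      constructor
      · intro h
        rw [S.flagsAfter_succ hn] at h
        exact ⟨_, _, _, _, _, h, rfl, by simp, rfl, rfl, rfl⟩
      · rintro ⟨l', a, d, r, g, h, rfl, rfl, rfl, rfl, rfl⟩
        rw [S.flagsAfter_succ hn]
        simpa using h
    rw [key]
    refine MeasurableSet.iUnion fun l' => MeasurableSet.iUnion fun a => MeasurableSet.iUnion fun d =>
      MeasurableSet.iUnion fun r => MeasurableSet.iUnion fun g => MeasurableSet.iUnion fun _ =>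
      MeasurableSet.inter (S.info.mono t.le_succ _ (ih l')) (MeasurableSet.inter
        (hb _ _ (S.isAdv_known t)) (MeasurableSet.inter (hb _ _ (S.deliver_known t _))
        (MeasurableSet.inter (S.reply_known t r) (hb _ _ (S.forward_known t _)))))

lemma measurable_comp_flagsAfter (S : Scenario μ β D) {n : ℕ} (hn : 1 ≤ n) (f : ℕ → D → D) (x : D)
    (t : ℕ) (g : Option (List Bool) → ℝ≥0∞) :
    Measurable[S.info t] fun ω => g (S.flagsAfter n f x t ω) := by
  intro s _
  have : (fun ω => g (S.flagsAfter n f x t ω)) ⁻¹' s =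
      ⋃ (l : Option (List Bool)) (_ : g l ∈ s), {ω | S.flagsAfter n f x t ω = l} := by
    ext ω; simp
  rw [this]
  exact MeasurableSet.iUnion fun l => MeasurableSet.iUnion fun _ =>
    S.measurableSet_flagsAfter hn f x t l

/-- Whatever is known before a round, the sampled worker is adversarial with probability at most
`β`, in integrated form. -/
lemma setLIntegral_isAdv_le (S : Scenario μ β D) (t : ℕ) {g : Ω → ℝ≥0∞}
    (hg : Measurable[S.info t] g) :
    ∫⁻ ω in {ω | S.isAdv t ω = true}, g ω ∂μ ≤ β * ∫⁻ ω, g ω ∂μ := by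
  have hm := S.info.le t
  -- On the sigma-algebra of prior knowledge, the sampling hypothesis is exactly an inequality of
  -- measures, so it extends from sets to nonnegative functions without conditional expectations.
  have hle : (μ.restrict {ω | S.isAdv t ω = true}).trim hm ≤ (β : ℝ≥0∞) • μ.trim hm := by
    refine Measure.le_iff.2 fun A hA => ?_
    rw [trim_measurableSet_eq hm hA, Measure.restrict_apply (hm A hA), Measure.smul_apply,
      trim_measurableSet_eq hm hA, smul_eq_mul]
    exact S.sampling t A hA
  calc ∫⁻ ω in {ω | S.isAdv t ω = true}, g ω ∂μ
      = ∫⁻ ω, g ω ∂((μ.restrict {ω | S.isAdv t ω = true}).trim hm) := (lintegral_trim hm hg).symm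
    _ ≤ ∫⁻ ω, g ω ∂((β : ℝ≥0∞) • μ.trim hm) := lintegral_mono' hle le_rfl
    _ = β * ∫⁻ ω, g ω ∂μ := by rw [lintegral_smul_measure, lintegral_trim hm hg, smul_eq_mul]

/-- The one-round estimate: `h` is the bound after an honest sample and `k` the nonnegative
surcharge for an adversarial one. This form suits a probability that is only bounded by `β`. -/
lemma lintegral_le_of_isAdv (S : Scenario μ β D) (t : ℕ) {X h k : Ω → ℝ≥0∞}
    (hh : Measurable[S.info t] h) (hk : Measurable[S.info t] k)
    (hX : ∀ ω, X ω ≤ h ω + {ω | S.isAdv t ω = true}.indicator k ω) :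
    ∫⁻ ω, X ω ∂μ ≤ ∫⁻ ω, h ω + β * k ω ∂μ := by
  calc ∫⁻ ω, X ω ∂μ ≤ ∫⁻ ω, h ω + {ω | S.isAdv t ω = true}.indicator k ω ∂μ := lintegral_mono hX
    _ = ∫⁻ ω, h ω ∂μ + ∫⁻ ω in {ω | S.isAdv t ω = true}, k ω ∂μ := by
      rw [lintegral_add_left (hh.mono (S.info.le t) le_rfl),
        lintegral_indicator (S.measurableSet_isAdv t)]
    _ ≤ ∫⁻ ω, h ω ∂μ + β * ∫⁻ ω, k ω ∂μ := by gcongr; exact S.setLIntegral_isAdv_le t hk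
    _ = ∫⁻ ω, h ω + β * k ω ∂μ := by
      rw [lintegral_add_left (hh.mono (S.info.le t) le_rfl),
        lintegral_const_mul _ (hk.mono (S.info.le t) le_rfl)]

/-- The number of adversarial workers is dominated, in exponential moments, by a binomial one. -/
lemma lintegral_two_pow_advCount_le (S : Scenario μ β D) [IsProbabilityMeasure μ] (t : ℕ) :
    Measurable[S.info t] (fun ω => (2 : ℝ≥0∞) ^ advCount (fun s => S.isAdv s ω) t) ∧
      ∫⁻ ω, 2 ^ advCount (fun s => S.isAdv s ω) t ∂μ ≤ (1 + β : ℝ≥0∞) ^ t := by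
  have hsucc : ∀ t ω, (2 : ℝ≥0∞) ^ advCount (fun s => S.isAdv s ω) (t + 1) =
      2 ^ advCount (fun s => S.isAdv s ω) t + {ω | S.isAdv t ω = true}.indicator
        (fun ω => 2 ^ advCount (fun s => S.isAdv s ω) t) ω := by
    intro t ω
    rw [advCount, Finset.sum_range_succ, ← advCount]
    by_cases h : S.isAdv t ω = true
    · simp [h, pow_succ, mul_two]
    · simp [h]
  induction t with
  | zero => exact ⟨by simp [advCount], by simp [advCount]⟩
  | succ t ih =>
    obtain ⟨hm, hi⟩ := ih
    refine ⟨?_, ?_⟩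
    · simp_rw [hsucc]
      have hm' := hm.mono (S.info.mono t.le_succ) le_rfl
      exact hm'.add (hm'.indicator (S.isAdv_known t))
    · refine (S.lintegral_le_of_isAdv t hm hm fun ω => (hsucc t ω).le).trans ?_
      have : ∀ ω, (2 : ℝ≥0∞) ^ advCount (fun s => S.isAdv s ω) t +
          β * 2 ^ advCount (fun s => S.isAdv s ω) t =
          (1 + β) * 2 ^ advCount (fun s => S.isAdv s ω) t := fun ω => by ring
      simp_rw [this]
      rw [lintegral_const_mul _ (hm.mono (S.info.le t) le_rfl), pow_succ']
      gcongr

/-! ### Expected visits by telescoping the potential -/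

/-- Indicator of a round starting at level `i`. -/
def atLevel (i : ℕ) : Option (List Bool) → ℝ≥0∞
  | none => 0
  | some L => if L.length = i then 1 else 0

/-- The expected number of rounds that start at a given level. -/
lemma tsum_lintegral_atLevel_le (S : Scenario μ β D) [IsProbabilityMeasure μ] (hβ : β ≤ 1 / 12)
    {n : ℕ} (hn : 1 ≤ n) (f : ℕ → D → D) (x : D) (i : ℕ) :
    ∑' t, ∫⁻ ω, atLevel i (S.flagsAfter n f x t ω) ∂μ ≤ 1 + 20 * β := by
  have h0 : (0 : ℝ) ≤ β := β.2
  have h1 : (β : ℝ) ≤ 1 / 12 := by exact_mod_cast hβ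
  choose H B hH hHB hF hFt hT hS hTt hV using exists_visitPotential_bounds h0 h1 i
  -- Termination has value zero, since no visits follow it. The surcharge `k` is `B - H`, which is
  -- why `H ≤ B` was required.
  let V : Option (List Bool) → ℝ≥0∞ := fun l =>
    l.elim 0 fun L => ENNReal.ofReal (visitPotential β i L)
  let h : Option (List Bool) → ℝ≥0∞ := fun l => l.elim 0 fun L => ENNReal.ofReal (H L)
  let k : Option (List Bool) → ℝ≥0∞ := fun l => l.elim 0 fun L => ENNReal.ofReal (B L - H L)
  have hstep : ∀ n a d r g l, V (flagStep n a d r g l) ≤ h l + if a = true then k l else 0 := by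
    intro n a d r g l
    rcases l with _ | L
    · simp [V, flagStep]
    rcases hL : flagStep n a d r g (some L) with _ | L'
    · simp [V]
    rcases a with _ | _
    · simp only [V, h, Option.elim, Bool.false_eq_true, if_false, add_zero]
      refine ENNReal.ofReal_le_ofReal ?_
      rcases flagStep_false hL with rfl | ⟨h1, rfl⟩
      exacts [hF L, hFt L h1]
    · simp only [V, h, k, Option.elim, if_true]
      rw [← ENNReal.ofReal_add (hH L) (sub_nonneg.2 (hHB L))]
      refine ENNReal.ofReal_le_ofReal ?_
      rcases flagStep_true hL with rfl | rfl | rfl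
      exacts [by linarith [hT L], by linarith [hS L'], by linarith [hTt L]]
  have hdec : ∀ l, atLevel i l + (h l + β * k l) ≤ V l := by
    rintro (_ | L)
    · simp [atLevel, h, k, V]
    have hB := sub_nonneg.2 (hHB L)
    have e : atLevel i (some L) = ENNReal.ofReal (if L.length = i then 1 else 0) := by
      simp only [atLevel]; split_ifs <;> simp
    have eβ : (β : ℝ≥0∞) = ENNReal.ofReal β := by simp
    simp only [h, k, V, Option.elim]
    rw [e, eβ, ← ENNReal.ofReal_mul h0, ← ENNReal.ofReal_add (hH L) (mul_nonneg h0 hB),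
      ← ENNReal.ofReal_add (by split_ifs <;> norm_num)
        (add_nonneg (hH L) (mul_nonneg h0 hB))]
    exact ENNReal.ofReal_le_ofReal (by linarith [hV L])
  have hmeas : ∀ t (g : Option (List Bool) → ℝ≥0∞),
      Measurable fun ω => g (S.flagsAfter n f x t ω) := fun t g =>
    (S.measurable_comp_flagsAfter hn f x t g).mono (S.info.le t) le_rfl
  have hsum : ∀ T, ∑ t ∈ Finset.range T, ∫⁻ ω, atLevel i (S.flagsAfter n f x t ω) ∂μ +
      ∫⁻ ω, V (S.flagsAfter n f x T ω) ∂μ ≤ V (some []) := by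
    intro T
    induction T with
    | zero => simp [flagsAfter, stateAfter, State.flags]
    | succ T ih =>
      refine le_trans ?_ ih
      rw [Finset.sum_range_succ, add_assoc]
      gcongr
      calc ∫⁻ ω, atLevel i (S.flagsAfter n f x T ω) ∂μ + ∫⁻ ω, V (S.flagsAfter n f x (T + 1) ω) ∂μ
          ≤ ∫⁻ ω, atLevel i (S.flagsAfter n f x T ω) ∂μ +
            ∫⁻ ω, h (S.flagsAfter n f x T ω) + β * k (S.flagsAfter n f x T ω) ∂μ := by
            gcongr 1
            refine S.lintegral_le_of_isAdv T (S.measurable_comp_flagsAfter hn f x T h)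
              (S.measurable_comp_flagsAfter hn f x T k) fun ω => ?_
            rw [S.flagsAfter_succ hn]
            refine (hstep _ _ _ _ _ _).trans (le_of_eq ?_)
            simp [Set.indicator_apply]
        _ = ∫⁻ ω, atLevel i (S.flagsAfter n f x T ω) + (h (S.flagsAfter n f x T ω) +
            β * k (S.flagsAfter n f x T ω)) ∂μ := (lintegral_add_left (hmeas T _) _).symm
        _ ≤ _ := lintegral_mono fun ω => hdec _
  have hstart : V (some []) ≤ 1 + 20 * β := by
    have : (1 + 20 * β : ℝ≥0∞) = ENNReal.ofReal (1 + 20 * β) := by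
      rw [ENNReal.ofReal_add (by norm_num) (by positivity), ENNReal.ofReal_mul (by norm_num)]
      simp
    rw [this]
    refine ENNReal.ofReal_le_ofReal ?_
    rw [visitPotential]
    have : 0 ≤ 9 * (β : ℝ) * (1 / 2) ^ i := by positivity
    linarith
  exact ENNReal.tsum_le_of_sum_range_le fun T => le_self_add.trans ((hsum T).trans hstart)

end Scenario
end

/-! ### Work per level and the optimal work -/

/-- The work of the honest workers in a round that starts at level `i` and involves no adversarial
worker. -/
noncomputable def levelWork (n : ℕ) (w : Work) (i : ℕ) : ℝ≥0 :=
  w.receive (i + 1) + w.verify (i + 1) +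
    (w.execute (i + 1) + if n ≤ i + 1 then w.send (i + 1) else 0) + if i = 0 then 0 else w.send i

lemma precedingWorkerWork_le {D : Type u} (w : Work) (L : List (Worker D)) :
    precedingWorkerWork w L ≤ if L.length = 0 then 0 else w.send L.length := by
  rcases L with _ | ⟨_ | _, L⟩ <;> simp [precedingWorkerWork]

lemma honestWork_running_le {D : Type u} (n : ℕ) (f : ℕ → D → D) (x : D) (w : Work) (a : Bool)
    (m : Move D) (L : List (Worker D)) :
    honestWork n f x w a m (State.running L) ≤ levelWork n w L.length := by
  rw [honestWork]
  refine ENNReal.coe_le_coe.2 (add_le_add ?_ (precedingWorkerWork_le w L))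
  rw [currentWorkerWork]
  split_ifs with h1 h2 h3 <;> simp

/-- The stack of a computation without adversarial workers. -/
def honestStack {D : Type u} (f : ℕ → D → D) (x : D) : ℕ → List (Worker D)
  | 0 => []
  | t + 1 => Worker.honest (correctOutput f x (t + 1)) :: honestStack f x t

lemma length_honestStack {D : Type u} (f : ℕ → D → D) (x : D) (t : ℕ) :
    (honestStack f x t).length = t := by
  induction t with
  | zero => rfl
  | succ t ih => simp [honestStack, ih]

lemma honestOutput_honestStack {D : Type u} (f : ℕ → D → D) (x : D) (m : Move D) (t : ℕ) :
    honestOutput f x m (honestStack f x t) = some (correctOutput f x (t + 1)) := by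
  have hl := length_honestStack f x t
  rcases t with _ | t
  · simp [honestOutput, honestStack, received, correctOutput]
  · rw [honestOutput, hl]
    simp [honestStack, received, correctOutput]

lemma stateAfter_honest {D : Type u} (n : ℕ) (f : ℕ → D → D) (x : D) (m : ℕ → Move D) (t : ℕ)
    (ht : t < n) :
    stateAfter n f x (fun _ => false) m t = State.running (honestStack f x t) := by
  induction t with
  | zero => rfl
  | succ t ih =>
    rw [stateAfter, ih (by omega)]
    simp [step, replyOf, honestOutput_honestStack, length_honestStack, ht, honestStack]

/-- The all-honest run starts round `i < n` at level `i` and performs exactly `levelWork` there. -/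
lemma sum_levelWork_le_optimalWork {D : Type u} (n : ℕ) (f : ℕ → D → D) (x : D) (w : Work) :
    ∑ i ∈ Finset.range n, (levelWork n w i : ℝ≥0∞) ≤ optimalWork n f x w := by
  refine le_trans (le_of_eq ?_) (ENNReal.sum_le_tsum (Finset.range n))
  refine Finset.sum_congr rfl fun i hi => ?_
  rw [stateAfter_honest n f x _ i (Finset.mem_range.1 hi), honestWork]
  congr 1
  rw [currentWorkerWork, honestOutput_honestStack, length_honestStack, levelWork]
  rcases i with _ | i <;> simp [honestStack, precedingWorkerWork, length_honestStack]

/-! ### Expected transmissions and honest work -/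

section
variable {Ω : Type v} [mΩ : MeasurableSpace Ω] {μ : Measure Ω} {β : ℝ≥0} {D : Type u}

namespace Scenario

lemma lintegral_tsum_atLevel_le (S : Scenario μ β D) [IsProbabilityMeasure μ] (hβ : β ≤ 1 / 12)
    {n : ℕ} (hn : 1 ≤ n) (f : ℕ → D → D) (x : D) (i : ℕ) :
    ∫⁻ ω, ∑' t, atLevel i (S.flagsAfter n f x t ω) ∂μ ≤ 1 + 20 * β := by
  rw [lintegral_tsum fun t => ((S.measurable_comp_flagsAfter hn f x t _).mono (S.info.le t)
    le_rfl).aemeasurable]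
  exact S.tsum_lintegral_atLevel_le hβ hn f x i

lemma lintegral_sourceCount_le (S : Scenario μ β D) [IsProbabilityMeasure μ] (hβ : β ≤ 1 / 12)
    {n : ℕ} (hn : 1 ≤ n) (f : ℕ → D → D) (x : D) :
    ∫⁻ ω, sourceCount n f x (fun s => S.isAdv s ω) (fun s => S.move s ω) ∂μ ≤ 1 + 20 * β := by
  refine le_trans (lintegral_mono fun ω => ?_) (S.lintegral_tsum_atLevel_le hβ hn f x 0)
  refine ENNReal.tsum_le_tsum fun t => ?_
  rw [flagsAfter]
  rcases stateAfter n f x (fun s => S.isAdv s ω) (fun s => S.move s ω) t with (_ | _) | _ <;>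
    simp [sourceSends, State.flags, atLevel]

lemma lintegral_targetCount_le (S : Scenario μ β D) [IsProbabilityMeasure μ] (hβ : β ≤ 1 / 12)
    {n : ℕ} (hn : 1 ≤ n) (f : ℕ → D → D) (x : D) :
    ∫⁻ ω, targetCount n f x (fun s => S.isAdv s ω) (fun s => S.move s ω) ∂μ ≤ 1 + 20 * β := by
  -- Levels count completed tasks, so the last task is current at level `n - 1`, the only level from
  -- which the target is addressed.
  refine le_trans (lintegral_mono fun ω => ?_) (S.lintegral_tsum_atLevel_le hβ hn f x (n - 1))
  refine ENNReal.tsum_le_tsum fun t => ?_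
  have hs := sound_stateAfter hn f x (fun s => S.isAdv s ω) (fun s => S.move s ω) t
  rw [flagsAfter]
  rcases h : stateAfter n f x (fun s => S.isAdv s ω) (fun s => S.move s ω) t with L | y
  · rw [h] at hs
    have hl := hs.1
    simp only [targetReceives, State.flags, atLevel, List.length_map]
    split_ifs with h1 h2
    · exact le_rfl
    · omega
    · exact zero_le
    · exact zero_le
  · simp [targetReceives]

lemma lintegral_totalHonestWork_le (S : Scenario μ β D) [IsProbabilityMeasure μ]
    (hβ : β ≤ 1 / 12) {n : ℕ} (hn : 1 ≤ n) (f : ℕ → D → D) (x : D) (w : Work) :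
    ∫⁻ ω, totalHonestWork n f x w (fun s => S.isAdv s ω) (fun s => S.move s ω) ∂μ ≤
      (1 + 20 * β) * optimalWork n f x w := by
  have hmeas : ∀ i t, Measurable fun ω => atLevel i (S.flagsAfter n f x t ω) := fun i t =>
    (S.measurable_comp_flagsAfter hn f x t _).mono (S.info.le t) le_rfl
  calc ∫⁻ ω, totalHonestWork n f x w (fun s => S.isAdv s ω) (fun s => S.move s ω) ∂μ
      ≤ ∫⁻ ω, ∑ i ∈ Finset.range n,
          (levelWork n w i : ℝ≥0∞) * ∑' t, atLevel i (S.flagsAfter n f x t ω) ∂μ := by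
        refine lintegral_mono fun ω => ?_
        simp_rw [← ENNReal.tsum_mul_left]
        rw [← Summable.tsum_finsetSum fun _ _ => ENNReal.summable]
        refine ENNReal.tsum_le_tsum fun t => ?_
        have hs := sound_stateAfter hn f x (fun s => S.isAdv s ω) (fun s => S.move s ω) t
        rw [flagsAfter]
        rcases h : stateAfter n f x (fun s => S.isAdv s ω) (fun s => S.move s ω) t with L | y
        · rw [h] at hs
          refine (honestWork_running_le n f x w _ _ L).trans ?_
          refine le_trans (le_of_eq ?_) (Finset.single_le_sum (fun _ _ => zero_le)
            (Finset.mem_range.2 hs.1))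
          simp [State.flags, atLevel]
        · simp [honestWork]
    _ = ∑ i ∈ Finset.range n, (levelWork n w i : ℝ≥0∞) *
          ∫⁻ ω, ∑' t, atLevel i (S.flagsAfter n f x t ω) ∂μ := by
        rw [lintegral_finsetSum _ fun i _ => (Measurable.tsum fun t => hmeas i t).const_mul _]
        exact Finset.sum_congr rfl fun i _ =>
          lintegral_const_mul _ (Measurable.tsum fun t => hmeas i t)
    _ ≤ ∑ i ∈ Finset.range n, (levelWork n w i : ℝ≥0∞) * (1 + 20 * β) := by
        gcongr with i
        exact S.lintegral_tsum_atLevel_le hβ hn f x i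
    _ = (1 + 20 * β) * ∑ i ∈ Finset.range n, (levelWork n w i : ℝ≥0∞) := by
        rw [← Finset.sum_mul, mul_comm]
    _ ≤ _ := by gcongr; exact sum_levelWork_le_optimalWork n f x w

/-! ### Termination with high probability -/

/-- With few adversarial workers the computation terminates in time. -/
lemma one_sub_le_of_advCount (S : Scenario μ β D) [IsProbabilityMeasure μ] {n : ℕ} (hn : 1 ≤ n)
    (f : ℕ → D → D) (x : D) {r δ : ℝ} {T : ℕ} (hT : T ≤ r)
    (h : μ.real {ω | T < n + 2 * advCount (fun s => S.isAdv s ω) T} ≤ δ) :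
    1 - δ ≤ μ.real {ω | ∃ t : ℕ, (t : ℝ) ≤ r ∧
      stateAfter n f x (fun s => S.isAdv s ω) (fun s => S.move s ω) t =
        State.finished (correctOutput f x n)} := by
  have h1 : (1 : ℝ) ≤ μ.real ({ω | T < n + 2 * advCount (fun s => S.isAdv s ω) T} ∪
      {ω | ∃ t : ℕ, (t : ℝ) ≤ r ∧
      stateAfter n f x (fun s => S.isAdv s ω) (fun s => S.move s ω) t =
        State.finished (correctOutput f x n)}) := by
    rw [← probReal_univ (μ := μ)]
    refine measureReal_mono fun ω _ => ?_
    by_cases hω : T < n + 2 * advCount (fun s => S.isAdv s ω) T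
    · exact Or.inl hω
    · exact Or.inr ⟨T, hT, eq_finished_of_advCount hn f x _ _ T (not_lt.1 hω)⟩
  linarith [h1.trans (measureReal_union_le _ _)]

/-- Markov's inequality for the exponential moment with base 2. -/
lemma measureReal_le_advCount_le (S : Scenario μ β D) [IsProbabilityMeasure μ] (T k : ℕ) :
    μ.real {ω | k ≤ advCount (fun s => S.isAdv s ω) T} ≤ (1 + β) ^ T / 2 ^ k := by
  obtain ⟨hm, hi⟩ := S.lintegral_two_pow_advCount_le T
  have h2 : (2 : ℝ≥0∞) ^ k ≠ 0 := by simp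
  have h2' : (2 : ℝ≥0∞) ^ k ≠ ∞ := by simp
  have hM := meas_ge_le_lintegral_div (μ := μ) (hm.mono (S.info.le T) le_rfl).aemeasurable h2 h2'
  have hle : μ {ω | k ≤ advCount (fun s => S.isAdv s ω) T} ≤
      ENNReal.ofReal ((1 + β) ^ T / 2 ^ k) := by
    calc μ {ω | k ≤ advCount (fun s => S.isAdv s ω) T}
        ≤ μ {ω | (2 : ℝ≥0∞) ^ k ≤ 2 ^ advCount (fun s => S.isAdv s ω) T} := by
          refine measure_mono fun ω hω => ?_
          exact pow_le_pow_right₀ (one_le_two (α := ℝ≥0∞)) hω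
      _ ≤ (1 + β : ℝ≥0∞) ^ T / 2 ^ k := hM.trans (by gcongr)
      _ = ENNReal.ofReal ((1 + β) ^ T / 2 ^ k) := by
          rw [ENNReal.ofReal_div_of_pos (by positivity),
            ENNReal.ofReal_pow (add_nonneg zero_le_one β.coe_nonneg),
            ENNReal.ofReal_pow (by positivity), ENNReal.ofReal_add zero_le_one β.coe_nonneg]
          simp
  exact ENNReal.toReal_le_of_le_ofReal (by positivity) hle

lemma ae_isAdv_eq_false (S : Scenario μ 0 D) : ∀ᵐ ω ∂μ, ∀ t, S.isAdv t ω = false := by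
  refine ae_all_iff.2 fun t => ?_
  have := S.sampling t Set.univ MeasurableSet.univ
  rw [Set.univ_inter, ENNReal.coe_zero, zero_mul, nonpos_iff_eq_zero] at this
  rw [ae_iff]
  simpa using this

end Scenario
end

/-- If the number of rounds exceeds the length of the path by `20βn`, then the bound on the
exponential moment makes the failure probability exponentially small. -/
lemma one_add_pow_div_two_pow_le {β : ℝ} (h0 : 0 ≤ β) (h1 : β ≤ 1 / 12) {n T k : ℕ}
    (hT : T ≤ (1 + 20 * β) * n) (hk : 10 * β * n ≤ k) :
    (1 + β) ^ T / 2 ^ k ≤ Real.exp (-(4 * β) * n) := by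
  have hlog := Real.log_two_gt_d9
  have hn : (0 : ℝ) ≤ n := n.cast_nonneg
  have e1 : (1 + β) ^ T ≤ Real.exp (β * ((1 + 20 * β) * n)) := by
    calc (1 + β) ^ T ≤ Real.exp β ^ T := by
          gcongr; linarith [Real.add_one_le_exp β]
      _ = Real.exp (T * β) := (Real.exp_nat_mul β T).symm
      _ ≤ _ := Real.exp_le_exp.2 (by nlinarith)
  have e2 : Real.exp (Real.log 2 * (10 * β * n)) ≤ (2 : ℝ) ^ k := by
    rw [← Real.rpow_natCast, Real.rpow_def_of_pos (by norm_num)]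
    exact Real.exp_le_exp.2 (by gcongr)
  calc (1 + β) ^ T / 2 ^ k
      ≤ Real.exp (β * ((1 + 20 * β) * n)) / Real.exp (Real.log 2 * (10 * β * n)) := by gcongr
    _ = Real.exp (β * ((1 + 20 * β) * n) - Real.log 2 * (10 * β * n)) := (Real.exp_sub _ _).symm
    _ ≤ _ := by
      refine Real.exp_le_exp.2 ?_
      have hβn : 0 ≤ β * n := by positivity
      have h2 : β * (β * n) ≤ 1 / 12 * (β * n) := by gcongr
      have h3 : 0.69 * (β * n) ≤ Real.log 2 * (β * n) := by gcongr; linarith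
      -- The exponent is at most `(1 + 20/12 - 6.9)βn`, which is below `-4βn`.
      nlinarith

lemma exists_exp_neg_mul_le_one_div_rpow {b : ℝ} (hb : 0 < b) (c : ℝ) :
    ∃ n₀ : ℕ, ∀ n : ℕ, n₀ ≤ n → Real.exp (-b * n) ≤ 1 / (n : ℝ) ^ c := by
  have h := ((tendsto_rpow_mul_exp_neg_mul_atTop_nhds_zero c b hb).comp
    tendsto_natCast_atTop_atTop).eventually (gt_mem_nhds one_pos)
  obtain ⟨n₀, hn₀⟩ := Filter.eventually_atTop.1 h
  refine ⟨n₀ + 1, fun n hn => ?_⟩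
  have hpos : (0 : ℝ) < n := by exact_mod_cast (by omega : 0 < n)
  rw [le_div_iff₀ (Real.rpow_pos_of_pos hpos c), mul_comm]
  exact (hn₀ n (by omega)).le

/-- Termination with high probability. -/
lemma exists_forall_one_sub_le_measureReal {β : ℝ≥0} (hβ : β ≤ 1 / 12) (c : ℝ) :
    ∃ n₀ : ℕ, ∀ n : ℕ, n₀ ≤ n → ∀ (D : Type u) (f : ℕ → D → D) (x : D)
      (Ω : Type v) [MeasurableSpace Ω] (μ : Measure Ω) [IsProbabilityMeasure μ]
      (S : Scenario μ β D),
      1 - 1 / (n : ℝ) ^ c ≤ μ.real {ω | ∃ t : ℕ, (t : ℝ) ≤ (1 + 20 * β) * n ∧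
        stateAfter n f x (fun s => S.isAdv s ω) (fun s => S.move s ω) t =
          State.finished (correctOutput f x n)} := by
  have h1 : (β : ℝ) ≤ 1 / 12 := by exact_mod_cast hβ
  -- For `β = 0` the exponential bound does not decay, but almost surely no adversarial worker is
  -- ever sampled.
  rcases eq_or_lt_of_le (zero_le (a := β)) with rfl | hpos
  · refine ⟨1, fun n hn D f x Ω _ μ _ S => ?_⟩
    refine S.one_sub_le_of_advCount hn f x (T := n) (by simp) (le_trans (le_of_eq ?_)
      (by positivity : (0 : ℝ) ≤ 1 / (n : ℝ) ^ c))
    have h : μ {ω | n < n + 2 * advCount (fun s => S.isAdv s ω) n} = 0 := by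
      have hae : ∀ᵐ ω ∂μ, ¬ n < n + 2 * advCount (fun s => S.isAdv s ω) n :=
        S.ae_isAdv_eq_false.mono fun ω h => by simp [advCount, h]
      simpa only [ae_iff, not_not] using hae
    rw [measureReal_def, h, ENNReal.toReal_zero]
  · have hpos' : (0 : ℝ) < β := hpos
    obtain ⟨n₀, hn₀⟩ := exists_exp_neg_mul_le_one_div_rpow (b := 4 * β) (by positivity) c
    refine ⟨n₀ + 1, fun n hn D f x Ω _ μ _ S => ?_⟩
    have hr : 0 ≤ (1 + 20 * (β : ℝ)) * n := by positivity
    have hT := Nat.floor_le hr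
    have hT' := Nat.lt_floor_add_one ((1 + 20 * (β : ℝ)) * n)
    set T := ⌊(1 + 20 * (β : ℝ)) * n⌋₊
    refine S.one_sub_le_of_advCount (by omega) f x hT (le_trans ?_ (hn₀ n (by omega)))
    refine le_trans (measureReal_mono fun ω (hω : T < _) => ?_)
      ((S.measureReal_le_advCount_le T ⌈10 * (β : ℝ) * n⌉₊).trans
        (one_add_pow_div_two_pow_le hpos'.le h1 hT (Nat.le_ceil _)))
    -- Failure gives `T + 1 ≤ n + 2 * advCount`, and the floor gives `(1 + 20β)n < T + 1`; hence
    -- more than `10βn` adversarial samples.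
    refine Nat.ceil_le.2 ?_
    have : (T : ℝ) + 1 ≤ n + 2 * (advCount (fun s => S.isAdv s ω) T : ℕ) := by exact_mod_cast hω
    linarith

end SupervisedPath

theorem theorem1 :
    ∃ C : ℝ≥0, ∀ β : ℝ≥0, β ≤ 1 / 12 →
      -- correct termination within (1 + O(β)) n rounds, with high probability in n
      (∀ c : ℝ, 0 < c → ∃ n₀ : ℕ, ∀ n : ℕ, n₀ ≤ n →
        ∀ (D : Type*) (f : ℕ → D → D) (x : D)
          (Ω : Type*) [MeasurableSpace Ω] (μ : Measure Ω) [IsProbabilityMeasure μ]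
          (S : SupervisedPath.Scenario μ β D),
          1 - 1 / (n : ℝ) ^ c ≤
            μ.real {ω | ∃ t : ℕ, (t : ℝ) ≤ (1 + C * β) * n ∧
              SupervisedPath.stateAfter n f x (fun s => S.isAdv s ω) (fun s => S.move s ω) t =
                SupervisedPath.State.finished (SupervisedPath.correctOutput f x n)}) ∧
      -- expected input and output transmissions and expected honest work
      (∀ n : ℕ, 1 ≤ n →
        ∀ (D : Type*) (f : ℕ → D → D) (x : D)
          (Ω : Type*) [MeasurableSpace Ω] (μ : Measure Ω) [IsProbabilityMeasure μ]
          (S : SupervisedPath.Scenario μ β D),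
          ∫⁻ ω, SupervisedPath.sourceCount n f x
              (fun s => S.isAdv s ω) (fun s => S.move s ω) ∂μ ≤ 1 + C * β ∧
          ∫⁻ ω, SupervisedPath.targetCount n f x
              (fun s => S.isAdv s ω) (fun s => S.move s ω) ∂μ ≤ 1 + C * β ∧
          ∀ w : SupervisedPath.Work,
            ∫⁻ ω, SupervisedPath.totalHonestWork n f x w
                (fun s => S.isAdv s ω) (fun s => S.move s ω) ∂μ ≤
              (1 + C * β) * SupervisedPath.optimalWork n f x w) := by
  refine ⟨20, fun β hβ => ⟨fun c _ => ?_, fun n hn D f x Ω _ μ _ S => ⟨?_, ?_, fun w => ?_⟩⟩⟩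
  · simpa using SupervisedPath.exists_forall_one_sub_le_measureReal hβ c
  · simpa using S.lintegral_sourceCount_le hβ hn f x
  · simpa using S.lintegral_targetCount_le hβ hn f x
  · simpa using S.lintegral_totalHonestWork_le hβ hn f x w
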